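/- **Theorem (triangle inequality for masking distances).** *Transition systems.* Let $\Sigma$ be a set of ordinary labels. A transition system over $\Sigma_F=\Sigma\cup F$, where $F$ is a set of fault labels with $F\cap\Sigma=\emptyset$, consists of a finite state set, the finite vocabulary $\Sigma_F$, a set of labelled transitions $s\xrightarrow{e}t$ with $e\in\Sigma_F$ such that every state has an outgoing transition, and an initial state. $A^M$ is $A$ with an additional loop $s\xrightarrow{M}s$ at each state, $M$ being a fresh label. For a silent label $\tau$ that is not a fault, the weak transition $\xRightarrow{e}$ of a system over $\Sigma_F$ is $(\xrightarrow{\tau})^*$ if $e=\tau$, $\xrightarrow{e}$ if $e\in F\cup\{M\}$, and $(\xrightarrow{\tau})^*\circ\xrightarrow{e}\circ(\xrightarrow{\tau})^*$ otherwise. *Games.* Let $A$ be a system over $\Sigma_F$ and $A'$ a system over $\Sigma_{F'}$ with $F\subseteq F'$, and let $s_0,s_0'$ be their initial states. In the strong masking game the labels in $N=\Sigma\cup F$ count as ordinary and those in $F'\setminus F$ as faults. The nodes are $(s,\#,s',R)$ (refuter), $(s,\sigma^1,s',V)$ and $(s,\sigma^2,s',V)$ (verifier), and $s_{err}$ (refuter);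 the initial node is $(s_0,\#,s_0',R)$. The edges are - $(s,\#,s',R)\xrightarrow{\sigma}(t,\sigma^1,s',V)$ for $s\xrightarrow{\sigma}t$ in $A$, $\sigma\in N$; - $(s,\#,s',R)\xrightarrow{\sigma}(s,\sigma^2,t',V)$ for $s'\xrightarrow{\sigma}t'$ in $A'$, $\sigma\in N\cup(F'\setminus F)$; - $(s,\sigma^2,s',V)\xrightarrow{\sigma}(t,\#,s',R)$ for $s\xrightarrow{\sigma}t$ in $A$, $\sigma\in N$; - $(s,\sigma^1,s',V)\xrightarrow{\sigma}(s,\#,t',R)$ for $s'\xrightarrow{\sigma}t'$ in $A'$, $\sigma\in N$; - $(s,f^2,s',V)\xrightarrow{M}(t,\#,s',R)$ for $s\xrightarrow{M}t$ in $A^M$, $f\in F'\setminus F$; - from each node without any of these edges (in particular from $s_{err}$), edges to $s_{err}$ labelled by all $\sigma\in N$. The payoff of a play $\rho_0\sigma_0\rho_1\sigma_1\dots$ is $$f_m(\rho)=\lim_{n\to\infty}\frac{\chi_{\{s_{err}\}}(\rho_{n+1})}{1+\sum_{i=0}^n\chi_{F'\setminus F}(\sigma_i)} .$$ The refuter maximizes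 it and the verifier minimizes it, both with history-dependent strategies. The strong masking distance $\delta_m(A,A')$ is the value of this game. The weak masking distance $\delta_m^W(A,A')$ is the value of the game that is defined in the same way with $N=\Sigma\cup F\cup\{\tau\}$ and with weak transitions of $A^M$ and $A'$ in place of transitions, where $\tau\notin F'$. *Claim.* Both games are determined ($\sup\inf=\inf\sup$), so that the distances are well defined, and: 1. $\delta_m(A,A')\ge 0$ and $\delta_m^W(A,A')\ge 0$ whenever $F\subseteq F'$; 2. $\delta_m(A,A)=0$ and $\delta_m^W(A,A)=0$ for every $A$; 3. if $A,A',A''$ are transition systems over $\Sigma_F,\Sigma_{F'},\Sigma_{F''}$ with $F\subseteq F'\subseteq F''$ (in particular if $A$ is a system over $\Sigma$, that is $F=\emptyset$, and $F'\subseteq F''$), then $$\delta_m(A,A'')\le\delta_m(A,A')+\delta_m(A',A''),\qquad \delta_m^W(A,A'')\le\delta_m^W(A,A')+\delta_m^W(A',A'').$$ In this sense both distances are directed semimetrics. -/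

import Mathlib

open Filter

namespace Masking

/-! ### Transition systems -/

/-- A transition system with state set `S` over the vocabulary `Sig ∪ F`, where `Sig` is the set of
ordinary labels and `F` is the set of fault labels. A system without faults has `F = ∅`. -/
structure TransitionSystem {L : Type*} (S : Type*) (Sig F : Set L) where
  finite_states : Finite S
  finite_labels : (Sig ∪ F).Finite
  disjoint : Disjoint Sig F
  /-- `Tr s e t` is the transition `s --e--> t`. -/
  Tr : S → L → S → Prop
  label_mem : ∀ {s e t}, Tr s e t → e ∈ Sig ∪ F
  init : S
  /-- Every state has a successor. -/
  total : ∀ s, ∃ e t, Tr s e t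

open Classical in
/-- The weak transition relation `s ==e==> t` with silent action `τ`: the reflexive transitive
closure of the `τ`-steps if `e = τ`, a plain step if `e` is a fault of the system, and
`τ* ∘ e ∘ τ*` for the other labels. -/
def TransitionSystem.WeakTr {L S : Type*} {Sig F : Set L} (A : TransitionSystem S Sig F) (τ : L)
    (s : S) (e : L) (t : S) : Prop :=
  if e = τ then Relation.ReflTransGen (fun p q => A.Tr p τ q) s t
  else if e ∈ F then A.Tr s e t
  else ∃ p q, Relation.ReflTransGen (fun p q => A.Tr p τ q) s p ∧ A.Tr p e q ∧
    Relation.ReflTransGen (fun p q => A.Tr p τ q) q t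

/-- Labels extended by the fresh masking label `M`. -/
inductive MLabel (L : Type*)
  | act (e : L)
  | M

/-- The relation of `A^M`: the relation of `A` together with a loop `s --M--> s` at every state.
As masking steps are never saturated by `τ`-steps, this also gives the weak relation of `A^M` from
that of `A`. -/
def addM {L S : Type*} (R : S → L → S → Prop) : S → MLabel L → S → Prop
  | s, .act e, t => R s e t
  | s, .M, t => s = t

/-! ### Two-player games on graphs -/

/-- A game graph; Player 1 moves at the nodes in `P₁`, Player 2 at the nodes in `P₁ᶜ`. -/
structure GameGraph (V Λ : Type*) where
  P₁ : Set V
  E : V → Λ → V → Prop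
  init : V

namespace GameGraph

variable {V Λ : Type*}

/-- A play `ρ₀ σ₀ ρ₁ σ₁ …`: an infinite path from the initial node. -/
structure Play (G : GameGraph V Λ) where
  node : ℕ → V
  label : ℕ → Λ
  node_zero : node 0 = G.init
  step : ∀ n, G.E (node n) (label n) (node (n + 1))

/-- A strategy of the player who owns the nodes in `P`. The history `ρ₀ σ₀ … ρᵢ` is given as the
list `[(ρ₀, σ₀), …, (ρᵢ₋₁, σᵢ₋₁)]` and the current node `ρᵢ`. Only the values at `ρᵢ ∈ P` matter. -/
structure Strategy (G : GameGraph V Λ) (P : Set V) where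
  move : List (V × Λ) → V → Λ × V
  valid : ∀ h v, v ∈ P → G.E v (move h v).1 (move h v).2

variable (G : GameGraph V Λ) (π₁ : G.Strategy G.P₁) (π₂ : G.Strategy G.P₁ᶜ)

open Classical in
/-- The move prescribed at node `v` after history `h`. -/
noncomputable def nextMove (h : List (V × Λ)) (v : V) : Λ × V :=
  if v ∈ G.P₁ then π₁.move h v else π₂.move h v

/-- History and current node after `n` moves. -/
noncomputable def outcomeAt : ℕ → List (V × Λ) × V
  | 0 => ([], G.init)
  | n + 1 =>
    let c := outcomeAt n
    let m := G.nextMove π₁ π₂ c.1 c.2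
    (c.1 ++ [(c.2, m.1)], m.2)

/-- The outcome of two strategies: the play that conforms to both. -/
noncomputable def outcome : G.Play where
  node n := (G.outcomeAt π₁ π₂ n).2
  label n := (G.nextMove π₁ π₂ (G.outcomeAt π₁ π₂ n).1 (G.outcomeAt π₁ π₂ n).2).1
  node_zero := rfl
  step n := by
    change G.E _ (G.nextMove π₁ π₂ _ _).1 (G.nextMove π₁ π₂ _ _).2
    unfold nextMove
    split_ifs with hv
    · exact π₁.valid _ _ hv
    · exact π₂.valid _ _ hv

/-- The value of the game with payoff `f` for Player 1 (the maximizer). -/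
noncomputable def value₁ (f : G.Play → ℝ) : ℝ :=
  ⨆ π₁ : G.Strategy G.P₁, ⨅ π₂ : G.Strategy G.P₁ᶜ, f (G.outcome π₁ π₂)

/-- The value of the game with payoff `f` for Player 2 (the minimizer). -/
noncomputable def value₂ (f : G.Play → ℝ) : ℝ :=
  ⨅ π₂ : G.Strategy G.P₁ᶜ, ⨆ π₁ : G.Strategy G.P₁, f (G.outcome π₁ π₂)

end GameGraph

/-! ### Masking games -/

/-- The superscript of a label in a verifier node: `spec` (written 1) if the refuter has moved in the
specification, `impl` (written 2) if she has moved in the implementation. -/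
inductive Side
  | spec
  | impl

/-- Nodes of masking games: `ref s s'` is `(s, #, s', R)`, `ver s i σ s'` is `(s, σⁱ, s', V)`, and
`err` is the error node. -/
inductive Node (L S S' : Type*)
  | ref (s : S) (s' : S')
  | ver (s : S) (i : Side) (σ : L) (s' : S')
  | err

section Game

variable {L S S' : Type*}

/-- The moves of the masking game that do not lead to the error node; `E` and `E'` are the
transition relations of specification and implementation, `N` is the vocabulary of the
specification, `F` is the set of faults of the implementation relative to it. -/
inductive Move (E : S → L → S → Prop) (E' : S' → L → S' → Prop) (N F : Set L) :
    Node L S S' → MLabel L → Node L S S' → Prop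
  | refSpec {s t s' σ} : σ ∈ N → E s σ t → Move E E' N F (.ref s s') (.act σ) (.ver t .spec σ s')
  | refImpl {s s' t' σ} : σ ∈ N ∪ F → E' s' σ t' →
      Move E E' N F (.ref s s') (.act σ) (.ver s .impl σ t')
  | verSpec {s t s' σ} : σ ∈ N → E s σ t → Move E E' N F (.ver s .impl σ s') (.act σ) (.ref t s')
  | verImpl {s s' t' σ} : σ ∈ N → E' s' σ t' →
      Move E E' N F (.ver s .spec σ s') (.act σ) (.ref s t')
  | verMask {s t s' f} : f ∈ F → addM E s .M t → Move E E' N F (.ver s .impl f s') .M (.ref t s')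

/-- The masking game graph. A node without moves (in particular the error node) gets edges to the
error node, labelled by all ordinary labels. Player 1 is the refuter. -/
def maskingGraph (E : S → L → S → Prop) (E' : S' → L → S' → Prop) (N F : Set L) (s₀ : S) (s₀' : S') :
    GameGraph (Node L S S') (MLabel L) where
  P₁ := {v | (∃ s s', v = .ref s s') ∨ v = .err}
  E v l w := Move E E' N F v l w ∨
    ((¬ ∃ l' w', Move E E' N F v l' w') ∧ (∃ σ ∈ N, l = .act σ) ∧ w = .err)
  init := .ref s₀ s₀'

open Classical in
/-- The weight `(χ_F(l), χ_err(w))` of an edge with label `l` and target `w`. -/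
noncomputable def weight (F : Set L) (l : MLabel L) (w : Node L S S') : ℝ × ℝ :=
  (if ∃ f ∈ F, l = .act f then 1 else 0, if w = .err then 1 else 0)

/-- The masking payoff `lim_n χ_err(n) / (1 + number of faults up to n)`. -/
noncomputable def maskingPayoff (F : Set L) {G : GameGraph (Node L S S') (MLabel L)}
    (ρ : G.Play) : ℝ :=
  limUnder atTop fun n : ℕ =>
    (weight F (ρ.label n) (ρ.node (n + 1))).2 /
      (1 + ∑ i ∈ Finset.range (n + 1), (weight F (ρ.label i) (ρ.node (i + 1))).1)

end Game

/-! ### Masking distances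

The specification `A` is over `Sig ∪ F` and the implementation `A'` is over `Sig ∪ F'`, with
`F ⊆ F'`. All labels of `A` count as ordinary in the game, so its faults are those in `F' \ F`. -/

namespace TransitionSystem

variable {L S S' : Type*} {Sig F F' : Set L}

/-- The strong masking game graph of `A^M` and `A'`. -/
def strongGraph (A : TransitionSystem S Sig F) (A' : TransitionSystem S' Sig F') :
    GameGraph (Node L S S') (MLabel L) :=
  maskingGraph A.Tr A'.Tr (Sig ∪ F) (F' \ F) A.init A'.init

/-- The weak masking game graph of `A^M` and `A'`, with silent action `τ`. -/
def weakGraph (τ : L) (A : TransitionSystem S Sig F) (A' : TransitionSystem S' Sig F') :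
    GameGraph (Node L S S') (MLabel L) :=
  maskingGraph (A.WeakTr τ) (A'.WeakTr τ) (Sig ∪ F ∪ {τ}) (F' \ F) A.init A'.init

/-- The value of the quantitative strong masking game for the refuter. -/
noncomputable def strongValR (A : TransitionSystem S Sig F) (A' : TransitionSystem S' Sig F') : ℝ :=
  (A.strongGraph A').value₁ (maskingPayoff (F' \ F))

/-- The value of the quantitative strong masking game for the verifier. -/
noncomputable def strongValV (A : TransitionSystem S Sig F) (A' : TransitionSystem S' Sig F') : ℝ :=
  (A.strongGraph A').value₂ (maskingPayoff (F' \ F))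

/-- The value of the quantitative weak masking game for the refuter. -/
noncomputable def weakValR (τ : L) (A : TransitionSystem S Sig F)
    (A' : TransitionSystem S' Sig F') : ℝ :=
  (A.weakGraph τ A').value₁ (maskingPayoff (F' \ F))

/-- The value of the quantitative weak masking game for the verifier. -/
noncomputable def weakValV (τ : L) (A : TransitionSystem S Sig F)
    (A' : TransitionSystem S' Sig F') : ℝ :=
  (A.weakGraph τ A').value₂ (maskingPayoff (F' \ F))

/-- The strong masking distance: the value of the quantitative strong masking game. The values for
both players agree; that is part of the theorem. -/
noncomputable def strongDist (A : TransitionSystem S Sig F) (A' : TransitionSystem S' Sig F') : ℝ :=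
  A.strongValV A'

/-- The weak masking distance: the value of the quantitative weak masking game. The values for both
players agree; that is part of the theorem. -/
noncomputable def weakDist (τ : L) (A : TransitionSystem S Sig F)
    (A' : TransitionSystem S' Sig F') : ℝ :=
  A.weakValV τ A'

end TransitionSystem

end Masking

open Masking

/-! The error node is absorbing and its loops carry no fault, so a play is worth `1 / (1 + k)` if it
reaches the error node after `k` faults, and `0` if it never does. Hence only one number matters:
the least `k` with which the refuter can force the error node.

`RefuterWins` describes forced wins by recursion on rounds, and `VerifierSafe` negates it for every
number of rounds. Because the state sets are finite, a safe position offers a safe reply to every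
move (`VerifierSafe.exists_impl`, `VerifierSafe.exists_spec`), so safety behaves like a bisimulation
with a fault budget. A win with `k` faults yields a refuter strategy guaranteeing `1 / (1 + k)`;
safety at budget `k` yields a verifier strategy conceding at most `1 / (2 + k)`. These bounds meet
at the least winning `k`, which gives determinacy.

For the triangle inequality, safe positions compose as bisimulations do (`VerifierSafe.trans`). A
fault of the composed game is masked in just one component; if this is the first, the middle system
answers it as an ordinary label of the second. So a win with `k` faults in the composed game gives a
win with `k` faults in a component, and the distance is bounded even by the maximum of the two.
Everything is proved for arbitrary transition relations, so the strong and weak games are both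
instances. -/

namespace Masking

/-! ### Values of games with payoffs in the unit interval -/

namespace GameGraph

variable {V Λ : Type*} {G : GameGraph V Λ}

theorem nonempty_strategy (P : Set V) (hG : ∀ v, ∃ l w, G.E v l w) : Nonempty (G.Strategy P) := by
  choose l w h using hG
  exact ⟨⟨fun _ v => (l v, w v), fun _ v _ => h v⟩⟩

section Value

variable {f : G.Play → ℝ}

/-- The bounds on `f`, together with nonempty strategy sets, keep the real suprema and infima from
taking their default value. -/
theorem le_value₁ (hG : ∀ v, ∃ l w, G.E v l w) (h0 : ∀ ρ, 0 ≤ f ρ) (h1 : ∀ ρ, f ρ ≤ 1)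
    {c : ℝ} (π₁ : G.Strategy G.P₁) (hc : ∀ π₂, c ≤ f (G.outcome π₁ π₂)) :
    c ≤ G.value₁ f := by
  have : Nonempty (G.Strategy G.P₁ᶜ) := nonempty_strategy _ hG
  refine le_ciSup_of_le ⟨1, ?_⟩ π₁ (le_ciInf hc)
  rintro _ ⟨π, rfl⟩
  exact ciInf_le_of_le ⟨0, by rintro _ ⟨π₂, rfl⟩; exact h0 _⟩ (Classical.arbitrary _) (h1 _)

theorem value₂_le (hG : ∀ v, ∃ l w, G.E v l w) (h0 : ∀ ρ, 0 ≤ f ρ) (h1 : ∀ ρ, f ρ ≤ 1)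
    {c : ℝ} (π₂ : G.Strategy G.P₁ᶜ) (hc : ∀ π₁, f (G.outcome π₁ π₂) ≤ c) :
    G.value₂ f ≤ c := by
  have : Nonempty (G.Strategy G.P₁) := nonempty_strategy _ hG
  refine ciInf_le_of_le ⟨0, ?_⟩ π₂ (ciSup_le hc)
  rintro _ ⟨π, rfl⟩
  exact le_ciSup_of_le ⟨1, by rintro _ ⟨π₁, rfl⟩; exact h1 _⟩ (Classical.arbitrary _) (h0 _)

theorem value₁_le_value₂ (hG : ∀ v, ∃ l w, G.E v l w) (h0 : ∀ ρ, 0 ≤ f ρ) (h1 : ∀ ρ, f ρ ≤ 1) :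
    G.value₁ f ≤ G.value₂ f := by
  have : Nonempty (G.Strategy G.P₁) := nonempty_strategy _ hG
  have : Nonempty (G.Strategy G.P₁ᶜ) := nonempty_strategy _ hG
  refine ciSup_le fun π₁ => le_ciInf fun π₂ => ?_
  exact (ciInf_le ⟨0, by rintro _ ⟨π₂, rfl⟩; exact h0 _⟩ π₂).trans
    (le_ciSup (f := fun π₁ => f (G.outcome π₁ π₂)) ⟨1, by rintro _ ⟨π₁, rfl⟩; exact h1 _⟩ π₁)

theorem value₁_nonneg (hG : ∀ v, ∃ l w, G.E v l w) (h0 : ∀ ρ, 0 ≤ f ρ) (h1 : ∀ ρ, f ρ ≤ 1) :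
    0 ≤ G.value₁ f :=
  le_value₁ hG h0 h1 (nonempty_strategy _ hG).some fun _ => h0 _

theorem value₂_le_one (hG : ∀ v, ∃ l w, G.E v l w) (h0 : ∀ ρ, 0 ≤ f ρ) (h1 : ∀ ρ, f ρ ≤ 1) :
    G.value₂ f ≤ 1 :=
  value₂_le hG h0 h1 (nonempty_strategy _ hG).some fun _ => h1 _

end Value

/-! ### Strategies that maintain an invariant -/

section Invariant

variable (Inv : List (V × Λ) → V → Prop)

/-- A strategy must be legal at every history, so an arbitrary edge is chosen wherever the invariant
fails. The invariant sees the history because the players have to count faults. -/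
theorem exists_maintaining_strategy (P : Set V) (hG : ∀ v, ∃ l w, G.E v l w)
    (hown : ∀ h v, v ∈ P → Inv h v → ∃ l w, G.E v l w ∧ Inv (h ++ [(v, l)]) w) :
    ∃ π : G.Strategy P, ∀ h v, v ∈ P → Inv h v →
      Inv (h ++ [(v, (π.move h v).1)]) (π.move h v).2 := by
  have key : ∀ h v, ∃ m : Λ × V, G.E v m.1 m.2 ∧ (v ∈ P → Inv h v → Inv (h ++ [(v, m.1)]) m.2) := by
    intro h v
    by_cases hv : v ∈ P ∧ Inv h v
    · obtain ⟨l, w, hE, hI⟩ := hown h v hv.1 hv.2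
      exact ⟨(l, w), hE, fun _ _ => hI⟩
    · obtain ⟨l, w, hE⟩ := hG v
      exact ⟨(l, w), hE, fun a b => absurd ⟨a, b⟩ hv⟩
  choose m hm using key
  exact ⟨⟨m, fun h v _ => (hm h v).1⟩, fun h v => (hm h v).2⟩

variable {Inv}

theorem exists_strategy₁_of_invariant (hG : ∀ v, ∃ l w, G.E v l w) (hinit : Inv [] G.init)
    (hown : ∀ h v, v ∈ G.P₁ → Inv h v → ∃ l w, G.E v l w ∧ Inv (h ++ [(v, l)]) w)
    (hopp : ∀ h v, v ∉ G.P₁ → Inv h v → ∀ l w, G.E v l w → Inv (h ++ [(v, l)]) w) :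
    ∃ π₁ : G.Strategy G.P₁, ∀ π₂ n,
      Inv (G.outcomeAt π₁ π₂ n).1 (G.outcomeAt π₁ π₂ n).2 := by
  obtain ⟨π₁, hπ⟩ := exists_maintaining_strategy Inv G.P₁ hG hown
  refine ⟨π₁, fun π₂ n => ?_⟩
  induction n with
  | zero => exact hinit
  | succ n ih =>
    simp only [outcomeAt, nextMove]
    split_ifs with hv
    · exact hπ _ _ hv ih
    · exact hopp _ _ hv ih _ _ (π₂.valid _ _ hv)

theorem exists_strategy₂_of_invariant (hG : ∀ v, ∃ l w, G.E v l w) (hinit : Inv [] G.init)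
    (hown : ∀ h v, v ∉ G.P₁ → Inv h v → ∃ l w, G.E v l w ∧ Inv (h ++ [(v, l)]) w)
    (hopp : ∀ h v, v ∈ G.P₁ → Inv h v → ∀ l w, G.E v l w → Inv (h ++ [(v, l)]) w) :
    ∃ π₂ : G.Strategy G.P₁ᶜ, ∀ π₁ n,
      Inv (G.outcomeAt π₁ π₂ n).1 (G.outcomeAt π₁ π₂ n).2 := by
  obtain ⟨π₂, hπ⟩ := exists_maintaining_strategy Inv G.P₁ᶜ hG hown
  refine ⟨π₂, fun π₁ n => ?_⟩
  induction n with
  | zero => exact hinit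
  | succ n ih =>
    simp only [outcomeAt, nextMove]
    split_ifs with hv
    · exact hopp _ _ hv ih _ _ (π₁.valid _ _ hv)
    · exact hπ _ _ hv ih

end Invariant

theorem outcomeAt_length (π₁ : G.Strategy G.P₁) (π₂ : G.Strategy G.P₁ᶜ) (n : ℕ) :
    (G.outcomeAt π₁ π₂ n).1.length = n := by
  induction n with
  | zero => rfl
  | succ n ih => simp [outcomeAt, ih]

end GameGraph

/-! ### The masking payoff -/

section Payoff

variable {L S S' : Type*} {E : S → L → S → Prop} {E' : S' → L → S' → Prop} {N F : Set L}
  {s₀ : S} {s₀' : S'}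

open Classical in
/-- The cost of a label: `1` for faults and `0` for other labels. -/
noncomputable def faultCost (F : Set L) (l : MLabel L) : ℕ := if ∃ f ∈ F, l = .act f then 1 else 0

theorem faultCost_fault {f : L} (hf : f ∈ F) : faultCost F (.act f) = 1 :=
  if_pos ⟨f, hf, rfl⟩

theorem faultCost_ordinary (hd : Disjoint N F) {σ : L} (hσ : σ ∈ N) : faultCost F (.act σ) = 0 := by
  refine if_neg ?_
  rintro ⟨f, hf, h⟩
  cases h
  exact Set.disjoint_left.1 hd hσ hf

theorem faultCost_mask : faultCost F .M = 0 := if_neg (by simp)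

theorem weight_fst (l : MLabel L) (w : Node L S S') : (weight F l w).1 = faultCost F l := by
  unfold weight faultCost
  split_ifs <;> simp

/-- The number of faults in a history. -/
noncomputable def faultCount {V : Type*} (F : Set L) (h : List (V × MLabel L)) : ℕ :=
  (h.map fun p => faultCost F p.2).sum

@[simp] theorem faultCount_nil {V : Type*} : faultCount F ([] : List (V × MLabel L)) = 0 := rfl

@[simp] theorem faultCount_append {V : Type*} (h : List (V × MLabel L)) (v : V) (l : MLabel L) :
    faultCount F (h ++ [(v, l)]) = faultCount F h + faultCost F l := by
  simp [faultCount]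

theorem faultCount_outcomeAt {G : GameGraph (Node L S S') (MLabel L)} (π₁ : G.Strategy G.P₁)
    (π₂ : G.Strategy G.P₁ᶜ) (n : ℕ) :
    faultCount F (G.outcomeAt π₁ π₂ n).1 =
      ∑ i ∈ Finset.range n, faultCost F ((G.outcome π₁ π₂).label i) := by
  induction n with
  | zero => rfl
  | succ n ih => rw [Finset.sum_range_succ, ← ih]; simp [GameGraph.outcomeAt, GameGraph.outcome]

theorem err_step {l : MLabel L} {w : Node L S S'}
    (h : (maskingGraph E E' N F s₀ s₀').E .err l w) : (∃ σ ∈ N, l = .act σ) ∧ w = .err := by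
  rcases h with h | h
  · cases h
  · exact h.2

theorem play_err_of_le (ρ : (maskingGraph E E' N F s₀ s₀').Play) {n m : ℕ}
    (hn : ρ.node n = .err) (hm : n ≤ m) : ρ.node m = .err := by
  induction m, hm using Nat.le_induction with
  | base => exact hn
  | succ m _ ih => exact (err_step (ih ▸ ρ.step m)).2

theorem sum_faultCost_of_err (hd : Disjoint N F) (ρ : (maskingGraph E E' N F s₀ s₀').Play) {n m : ℕ}
    (hn : ρ.node n = .err) (hm : n ≤ m) :
    ∑ i ∈ Finset.range m, faultCost F (ρ.label i) =
      ∑ i ∈ Finset.range n, faultCost F (ρ.label i) := by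
  induction m, hm using Nat.le_induction with
  | base => rfl
  | succ m hm ih =>
    obtain ⟨σ, hσ, h⟩ := (err_step (play_err_of_le ρ hn hm ▸ ρ.step m)).1
    rw [Finset.sum_range_succ, ih, h, faultCost_ordinary hd hσ, add_zero]

/-- After the error node only labels from `N` occur; by disjointness none is a fault, so the
sequence defining the payoff is eventually constant. -/
theorem maskingPayoff_of_err (hd : Disjoint N F) (ρ : (maskingGraph E E' N F s₀ s₀').Play) {n : ℕ}
    (hn : ρ.node n = .err) :
    maskingPayoff F ρ = 1 / (1 + (∑ i ∈ Finset.range n, faultCost F (ρ.label i) : ℕ)) := by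
  refine Tendsto.limUnder_eq (tendsto_const_nhds.congr' ?_)
  filter_upwards [eventually_ge_atTop n] with m hm
  have hm' : n ≤ m + 1 := hm.trans (Nat.le_succ m)
  simp only [weight_fst]
  rw [← sum_faultCost_of_err hd ρ hn hm']
  simp [weight, play_err_of_le ρ hn hm']

theorem maskingPayoff_of_forall_ne_err (ρ : (maskingGraph E E' N F s₀ s₀').Play)
    (hρ : ∀ n, ρ.node n ≠ .err) : maskingPayoff F ρ = 0 := by
  refine Tendsto.limUnder_eq (tendsto_const_nhds.congr fun m => ?_)
  simp [weight, hρ (m + 1)]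

theorem maskingPayoff_nonneg (hd : Disjoint N F) (ρ : (maskingGraph E E' N F s₀ s₀').Play) :
    0 ≤ maskingPayoff F ρ := by
  by_cases h : ∃ n, ρ.node n = .err
  · obtain ⟨n, hn⟩ := h
    rw [maskingPayoff_of_err hd ρ hn]
    positivity
  · exact (maskingPayoff_of_forall_ne_err ρ (not_exists.1 h)).ge

theorem maskingPayoff_le_of_faults (hd : Disjoint N F) (ρ : (maskingGraph E E' N F s₀ s₀').Play)
    {k : ℕ} (hk : ∀ n, ρ.node n = .err → k ≤ ∑ i ∈ Finset.range n, faultCost F (ρ.label i)) :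
    maskingPayoff F ρ ≤ 1 / (1 + k) := by
  by_cases h : ∃ n, ρ.node n = .err
  · obtain ⟨n, hn⟩ := h
    rw [maskingPayoff_of_err hd ρ hn]
    have := hk n hn
    gcongr
  · rw [maskingPayoff_of_forall_ne_err ρ (not_exists.1 h)]
    positivity

theorem maskingPayoff_le_one (hd : Disjoint N F) (ρ : (maskingGraph E E' N F s₀ s₀').Play) :
    maskingPayoff F ρ ≤ 1 := by
  simpa using maskingPayoff_le_of_faults hd ρ (k := 0) fun _ _ => Nat.zero_le _

end Payoff

/-! ### Winning positions of the refuter -/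

section Winning

variable {L S S' S'' : Type*}

/-- The refuter can force the error node from `(s, #, s', R)` within `m` rounds and with at most
`r` faults. -/
def RefuterWins (E : S → L → S → Prop) (E' : S' → L → S' → Prop) (N F : Set L) :
    ℕ → ℕ → S → S' → Prop
  -- A win arises only in a round whose universal quantifier over replies is vacuous, that is, when
  -- the verifier is stuck. A fault can always be masked, so the last clause has no quantifier over
  -- replies.
  | 0, _, _, _ => False
  | m + 1, r, s, s' =>
    (∃ σ ∈ N, ∃ t, E s σ t ∧ ∀ t', E' s' σ t' → RefuterWins E E' N F m r t t') ∨
    (∃ σ ∈ N, ∃ t', E' s' σ t' ∧ ∀ t, E s σ t → RefuterWins E E' N F m r t t') ∨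
    (∃ f ∈ F, ∃ t', E' s' f t' ∧ ∃ q, r = q + 1 ∧ RefuterWins E E' N F m q s t')

variable {E : S → L → S → Prop} {E' : S' → L → S' → Prop} {E'' : S'' → L → S'' → Prop} {N F : Set L}

theorem RefuterWins.mono {m m' r r' : ℕ} {s : S} {s' : S'} (h : RefuterWins E E' N F m r s s')
    (hm : m ≤ m') (hr : r ≤ r') : RefuterWins E E' N F m' r' s s' := by
  induction m generalizing m' r r' s s' with
  | zero => exact h.elim
  | succ m ih =>
    obtain ⟨m', rfl⟩ : ∃ p, m' = p + 1 := ⟨m' - 1, by omega⟩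
    have hm : m ≤ m' := by omega
    rcases h with ⟨σ, hσ, t, ht, h⟩ | ⟨σ, hσ, t', ht, h⟩ | ⟨f, hf, t', ht, q, rfl, h⟩
    · exact .inl ⟨σ, hσ, t, ht, fun t' ht' => ih (h t' ht') hm hr⟩
    · exact .inr (.inl ⟨σ, hσ, t', ht, fun t ht' => ih (h t ht') hm hr⟩)
    · exact .inr (.inr ⟨f, hf, t', ht, r' - 1, by omega, ih h hm (by omega)⟩)

/-- The verifier can avoid the error node forever, or until more than `r` faults have occurred. -/
def VerifierSafe (E : S → L → S → Prop) (E' : S' → L → S' → Prop) (N F : Set L) (r : ℕ)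
    (s : S) (s' : S') : Prop :=
  ∀ m, ¬ RefuterWins E E' N F m r s s'

theorem VerifierSafe.anti {r r' : ℕ} {s : S} {s' : S'} (h : VerifierSafe E E' N F r' s s')
    (hr : r ≤ r') : VerifierSafe E E' N F r s s' :=
  fun m hm => h m (hm.mono le_rfl hr)

/-- Over a finite family of positions that are all won by the refuter, a common bound on the number
of rounds exists. -/
theorem exists_uniform_bound {T : Type*} [Finite T] {p : T → Prop} {W : ℕ → T → Prop}
    (hW : ∀ {m m' t}, m ≤ m' → W m t → W m' t) (h : ∀ t, p t → ∃ m, W m t) :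
    ∃ m, ∀ t, p t → W m t := by
  have : ∀ t, ∃ m, p t → W m t := fun t => by
    by_cases hp : p t
    · exact (h t hp).imp fun _ hm _ => hm
    · exact ⟨0, fun hp' => absurd hp' hp⟩
  choose m hm using this
  obtain ⟨M, hM⟩ := (Set.finite_range m).bddAbove
  exact ⟨M, fun t ht => hW (hM ⟨t, rfl⟩) (hm t ht)⟩

/-- If every reply were lost, each with its own number of rounds, finiteness would give a common
bound `m`, and the refuter would win in `m + 1` rounds. -/
theorem VerifierSafe.exists_impl [Finite S'] {r : ℕ} {s t : S} {s' : S'} {σ : L}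
    (h : VerifierSafe E E' N F r s s') (hσ : σ ∈ N) (ht : E s σ t) :
    ∃ t', E' s' σ t' ∧ VerifierSafe E E' N F r t t' := by
  by_contra! hc
  obtain ⟨m, hm⟩ := exists_uniform_bound (p := E' s' σ)
    (W := fun m t' => RefuterWins E E' N F m r t t') (fun hm hW => hW.mono hm le_rfl)
    (fun t' ht' => by simpa [VerifierSafe] using hc t' ht')
  exact h (m + 1) (.inl ⟨σ, hσ, t, ht, hm⟩)

theorem VerifierSafe.exists_spec [Finite S] {r : ℕ} {s : S} {s' t' : S'} {σ : L}
    (h : VerifierSafe E E' N F r s s') (hσ : σ ∈ N) (ht : E' s' σ t') :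
    ∃ t, E s σ t ∧ VerifierSafe E E' N F r t t' := by
  by_contra! hc
  obtain ⟨m, hm⟩ := exists_uniform_bound (p := E s σ)
    (W := fun m t => RefuterWins E E' N F m r t t') (fun hm hW => hW.mono hm le_rfl)
    (fun t ht => by simpa [VerifierSafe] using hc t ht)
  exact h (m + 1) (.inr (.inl ⟨σ, hσ, t', ht, hm⟩))

theorem VerifierSafe.fault {r : ℕ} {s : S} {s' t' : S'} {f : L}
    (h : VerifierSafe E E' N F (r + 1) s s') (hf : f ∈ F) (ht : E' s' f t') :
    VerifierSafe E E' N F r s t' :=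
  fun m hm => h (m + 1) (.inr (.inr ⟨f, hf, t', ht, r, rfl, hm⟩))

/-- The verifier copies every move, and there are no faults to mask. -/
theorem verifierSafe_refl (r : ℕ) (s : S) : VerifierSafe E E N ∅ r s s := by
  intro m
  induction m generalizing r s with
  | zero => exact id
  | succ m ih =>
    rintro (⟨σ, hσ, t, ht, h⟩ | ⟨σ, hσ, t', ht, h⟩ | ⟨f, hf, -⟩)
    · exact ih r t (h t ht)
    · exact ih r t' (h t' ht)
    · exact hf

/-- Safe positions compose: every fault of the composed game is a fault in exactly one of the two
component games that has to be paid for. -/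
theorem VerifierSafe.trans [Finite S] [Finite S'] [Finite S''] {N₁ N₂ F₁ F₂ F₃ : Set L}
    (hN : N₁ ⊆ N₂) (hF : ∀ f ∈ F₃, (f ∈ N₂ ∧ f ∈ F₁) ∨ f ∈ F₂) {r : ℕ} {s : S} {s' : S'} {s'' : S''}
    (h₁ : VerifierSafe E E' N₁ F₁ r s s') (h₂ : VerifierSafe E' E'' N₂ F₂ r s' s'') :
    VerifierSafe E E'' N₁ F₃ r s s'' := by
  intro m
  induction m generalizing r s s' s'' with
  | zero => exact id
  | succ m ih =>
    rintro (⟨σ, hσ, t, ht, h⟩ | ⟨σ, hσ, t'', ht, h⟩ | ⟨f, hf, t'', ht, q, rfl, h⟩)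
    · obtain ⟨t', ht', k₁⟩ := h₁.exists_impl hσ ht
      obtain ⟨t'', ht'', k₂⟩ := h₂.exists_impl (hN hσ) ht'
      exact ih k₁ k₂ (h t'' ht'')
    · obtain ⟨t', ht', k₂⟩ := h₂.exists_spec (hN hσ) ht
      obtain ⟨t, ht, k₁⟩ := h₁.exists_spec hσ ht'
      exact ih k₁ k₂ (h t ht)
    -- One component pays for the fault; the other keeps its budget and is weakened by
    -- `VerifierSafe.anti` to match.
    · rcases hF f hf with ⟨hfN, hf₁⟩ | hf₂
      · obtain ⟨t', ht', k₂⟩ := h₂.exists_spec hfN ht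
        exact ih (h₁.fault hf₁ ht') (k₂.anti (Nat.le_succ q)) h
      · exact ih (h₁.anti (Nat.le_succ q)) (h₂.fault hf₂ ht) h

end Winning

/-! ### From winning positions to values -/

section Values

variable {L S S' S'' : Type*} {E : S → L → S → Prop} {E' : S' → L → S' → Prop}
  {E'' : S'' → L → S'' → Prop} {N F : Set L} {s₀ : S} {s₀' : S'}

theorem maskingGraph_total (hN : N.Nonempty) (v : Node L S S') :
    ∃ l w, (maskingGraph E E' N F s₀ s₀').E v l w := by
  by_cases h : ∃ l w, Move E E' N F v l w
  · exact h.imp fun l => Exists.imp fun w => Or.inl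
  · obtain ⟨σ, hσ⟩ := hN
    exact ⟨.act σ, .err, .inr ⟨h, ⟨σ, hσ, rfl⟩, rfl⟩⟩

/-- Totality of the specification means that the refuter is never stuck, so she cannot fall into the
error node by her own move. -/
theorem maskingGraph_ref_move (hE : ∀ s, ∃ σ ∈ N, ∃ t, E s σ t) {s : S} {s' : S'} {l : MLabel L}
    {w : Node L S S'} (h : (maskingGraph E E' N F s₀ s₀').E (.ref s s') l w) :
    Move E E' N F (.ref s s') l w := by
  rcases h with h | h
  · exact h
  · obtain ⟨σ, hσ, t, ht⟩ := hE s
    exact absurd ⟨_, _, .refSpec hσ ht⟩ h.1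

theorem ref_mem_P₁ (s : S) (s' : S') :
    (.ref s s' : Node L S S') ∈ (maskingGraph E E' N F s₀ s₀').P₁ := .inl ⟨s, s', rfl⟩

theorem err_mem_P₁ : (.err : Node L S S') ∈ (maskingGraph E E' N F s₀ s₀').P₁ := .inr rfl

theorem ver_notMem_P₁ (s : S) (i : Side) (σ : L) (s' : S') :
    (.ver s i σ s' : Node L S S') ∉ (maskingGraph E E' N F s₀ s₀').P₁ := by
  rintro (⟨_, _, h⟩ | h) <;> cases h

/-- The invariant of a refuter who wins within `n` rounds and with at most `k` faults. -/
def RefuterInv (E : S → L → S → Prop) (E' : S' → L → S' → Prop) (N F : Set L) (n k : ℕ)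
    (h : List (Node L S S' × MLabel L)) : Node L S S' → Prop
  | .err => faultCount F h ≤ k
  | .ref s s' => ∃ m r, h.length + 2 * m = 2 * n ∧ faultCount F h + r = k ∧
      RefuterWins E E' N F m r s s'
  | .ver s .spec σ s' => ∃ m r, h.length + 2 * m + 1 = 2 * n ∧ faultCount F h + r = k ∧ σ ∈ N ∧
      ∀ t', E' s' σ t' → RefuterWins E E' N F m r s t'
  | .ver s .impl σ s' => ∃ m r, h.length + 2 * m + 1 = 2 * n ∧ faultCount F h + r = k ∧
      ((σ ∈ N ∧ ∀ t, E s σ t → RefuterWins E E' N F m r t s') ∨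
        (σ ∈ F ∧ RefuterWins E E' N F m r s s'))

theorem RefuterInv.exists_step (hd : Disjoint N F) (hN : N.Nonempty) {n k : ℕ}
    {h : List (Node L S S' × MLabel L)} {v : Node L S S'}
    (hv : v ∈ (maskingGraph E E' N F s₀ s₀').P₁) (hI : RefuterInv E E' N F n k h v) :
    ∃ l w, (maskingGraph E E' N F s₀ s₀').E v l w ∧
      RefuterInv E E' N F n k (h ++ [(v, l)]) w := by
  rcases v with ⟨s, s'⟩ | ⟨s, i, σ, s'⟩ | _
  · obtain ⟨m, r, hm, hr, hW⟩ := hI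
    cases m with
    | zero => exact hW.elim
    | succ m =>
      rcases hW with ⟨σ, hσ, t, ht, hW⟩ | ⟨σ, hσ, t', ht, hW⟩ | ⟨f, hf, t', ht, q, rfl, hW⟩
      · refine ⟨_, _, .inl (.refSpec hσ ht), m, r, ?_, ?_, hσ, hW⟩
        · simp; omega
        · simp [faultCost_ordinary hd hσ, hr]
      · refine ⟨_, _, .inl (.refImpl (.inl hσ) ht), m, r, ?_, ?_, .inl ⟨hσ, hW⟩⟩
        · simp; omega
        · simp [faultCost_ordinary hd hσ, hr]
      · refine ⟨_, _, .inl (.refImpl (.inr hf) ht), m, q, ?_, ?_, .inr ⟨hf, hW⟩⟩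
        · simp; omega
        · simp [faultCost_fault hf]; omega
  · exact absurd hv (ver_notMem_P₁ _ _ _ _)
  · obtain ⟨l, w, hE⟩ := maskingGraph_total (E := E) (E' := E') (F := F) (s₀ := s₀) (s₀' := s₀') hN
      (.err : Node L S S')
    obtain ⟨⟨σ, hσ, rfl⟩, rfl⟩ := err_step hE
    exact ⟨_, _, hE, by simpa [RefuterInv, faultCost_ordinary hd hσ] using hI⟩

theorem RefuterInv.step (hd : Disjoint N F) {n k : ℕ} {h : List (Node L S S' × MLabel L)}
    {v : Node L S S'} (hv : v ∉ (maskingGraph E E' N F s₀ s₀').P₁) (hI : RefuterInv E E' N F n k h v)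
    {l : MLabel L} {w : Node L S S'} (hE : (maskingGraph E E' N F s₀ s₀').E v l w) :
    RefuterInv E E' N F n k (h ++ [(v, l)]) w := by
  rcases v with ⟨s, s'⟩ | ⟨s, i, σ, s'⟩ | _
  · exact absurd (ref_mem_P₁ _ _) hv
  · rcases hE with hE | ⟨-, ⟨σ, hσ, rfl⟩, rfl⟩
    · cases hE with
      | verSpec hσ ht =>
        obtain ⟨m, r, hm, hr, ⟨-, hW⟩ | ⟨hf, -⟩⟩ := hI
        · exact ⟨m, r, by simp; omega, by simp [faultCost_ordinary hd hσ, hr], hW _ ht⟩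
        · exact (Set.disjoint_left.1 hd hσ hf).elim
      | verImpl hσ ht =>
        obtain ⟨m, r, hm, hr, -, hW⟩ := hI
        exact ⟨m, r, by simp; omega, by simp [faultCost_ordinary hd hσ, hr], hW _ ht⟩
      | verMask hf ht =>
        cases ht
        obtain ⟨m, r, hm, hr, ⟨hσ, -⟩ | ⟨-, hW⟩⟩ := hI
        · exact (Set.disjoint_left.1 hd hσ hf).elim
        · exact ⟨m, r, by simp; omega, by simp [faultCost_mask, hr], hW⟩
    -- Here the verifier was stuck and moved to the error node, where only the fault bound has to be
    -- kept.
    · have hle : faultCount F h ≤ k := by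
        cases i
        · obtain ⟨m, r, -, hr, -⟩ := hI; omega
        · obtain ⟨m, r, -, hr, -⟩ := hI; omega
      simpa [RefuterInv, faultCost_ordinary hd hσ] using hle
  · exact absurd err_mem_P₁ hv

/-- A round consists of two moves: parity excludes verifier nodes, and a refuter node would need a
win in zero rounds. -/
theorem RefuterInv.eq_err {n k : ℕ} {h : List (Node L S S' × MLabel L)} {v : Node L S S'}
    (hI : RefuterInv E E' N F n k h v) (hn : h.length = 2 * n) :
    v = .err ∧ faultCount F h ≤ k := by
  rcases v with ⟨s, s'⟩ | ⟨s, i, σ, s'⟩ | _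
  · obtain ⟨m, r, hm, -, hW⟩ := hI
    obtain rfl : m = 0 := by omega
    exact hW.elim
  · cases i
    · obtain ⟨m, r, hm, -⟩ := hI; omega
    · obtain ⟨m, r, hm, -⟩ := hI; omega
  · exact ⟨rfl, hI⟩

theorem le_value₁_of_refuterWins (hd : Disjoint N F) (hN : N.Nonempty) {n k : ℕ}
    (hW : RefuterWins E E' N F n k s₀ s₀') :
    1 / (1 + (k : ℝ)) ≤ (maskingGraph E E' N F s₀ s₀').value₁ (maskingPayoff F) := by
  obtain ⟨π₁, hπ⟩ := GameGraph.exists_strategy₁_of_invariant (G := maskingGraph E E' N F s₀ s₀')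
    (Inv := RefuterInv E E' N F n k) (maskingGraph_total hN)
    ⟨n, k, by simp, by simp, hW⟩ (fun _ _ hv hI => hI.exists_step hd hN hv)
    (fun _ _ hv hI _ _ hE => hI.step hd hv hE)
  refine GameGraph.le_value₁ (maskingGraph_total hN) (maskingPayoff_nonneg hd)
    (maskingPayoff_le_one hd) π₁ fun π₂ => ?_
  obtain ⟨herr, hk⟩ := (hπ π₂ (2 * n)).eq_err (GameGraph.outcomeAt_length _ _ _)
  rw [maskingPayoff_of_err hd (GameGraph.outcome _ π₁ π₂) herr, ← faultCount_outcomeAt]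
  gcongr

/-- The invariant of a verifier who avoids the error node as long as at most `k` faults have
occurred. -/
def VerifierInv (E : S → L → S → Prop) (E' : S' → L → S' → Prop) (N F : Set L) (k : ℕ)
    (h : List (Node L S S' × MLabel L)) (v : Node L S S') : Prop :=
  ∀ r, faultCount F h + r = k → match v with
  | .err => False
  | .ref s s' => VerifierSafe E E' N F r s s'
  | .ver s .spec σ s' => σ ∈ N ∧ ∃ t', E' s' σ t' ∧ VerifierSafe E E' N F r s t'
  | .ver s .impl σ s' => (σ ∈ N ∧ ∃ t, E s σ t ∧ VerifierSafe E E' N F r t s') ∨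
      (σ ∈ F ∧ VerifierSafe E E' N F r s s')

theorem VerifierInv.exists_step (hd : Disjoint N F) (hN : N.Nonempty) {k : ℕ}
    {h : List (Node L S S' × MLabel L)} {v : Node L S S'}
    (hv : v ∉ (maskingGraph E E' N F s₀ s₀').P₁) (hI : VerifierInv E E' N F k h v) :
    ∃ l w, (maskingGraph E E' N F s₀ s₀').E v l w ∧
      VerifierInv E E' N F k (h ++ [(v, l)]) w := by
  by_cases hk : ∃ r, faultCount F h + r = k
  · obtain ⟨r, hr⟩ := hk
    have hI := hI r hr
    rcases v with ⟨s, s'⟩ | ⟨s, _ | _, σ, s'⟩ | _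
    · exact absurd (ref_mem_P₁ _ _) hv
    · obtain ⟨hσ, t', ht, hS⟩ := hI
      refine ⟨_, _, .inl (.verImpl hσ ht), fun q hq => ?_⟩
      obtain rfl : q = r := by
        simp [faultCost_ordinary hd hσ] at hq; omega
      exact hS
    · rcases hI with ⟨hσ, t, ht, hS⟩ | ⟨hf, hS⟩
      · refine ⟨_, _, .inl (.verSpec hσ ht), fun q hq => ?_⟩
        obtain rfl : q = r := by
          simp [faultCost_ordinary hd hσ] at hq; omega
        exact hS
      · refine ⟨_, _, .inl (.verMask hf rfl), fun q hq => ?_⟩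
        obtain rfl : q = r := by
          simp [faultCost_mask] at hq; omega
        exact hS
    · exact hI.elim
  -- The budget is already exceeded. Fault counts never decrease, so the invariant is vacuous from
  -- here on and any edge will do.
  · obtain ⟨l, w, hE⟩ := maskingGraph_total (E := E) (E' := E') (F := F) (s₀ := s₀) (s₀' := s₀') hN v
    refine ⟨l, w, hE, fun q hq => absurd ⟨faultCost F l + q, ?_⟩ hk⟩
    rw [← hq, faultCount_append, add_assoc]

/-- The safe reply is found as soon as the refuter moves, and the invariant at the verifier node
records that it exists. A fault is charged at the refuter's move; the masking reply is free. -/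
theorem VerifierInv.step [Finite S] [Finite S'] (hd : Disjoint N F)
    (htot : ∀ s, ∃ σ ∈ N, ∃ t, E s σ t) {k : ℕ} {h : List (Node L S S' × MLabel L)}
    {v : Node L S S'} (hv : v ∈ (maskingGraph E E' N F s₀ s₀').P₁)
    (hI : VerifierInv E E' N F k h v) {l : MLabel L} {w : Node L S S'}
    (hE : (maskingGraph E E' N F s₀ s₀').E v l w) :
    VerifierInv E E' N F k (h ++ [(v, l)]) w := by
  intro q hq
  rw [faultCount_append, add_assoc] at hq
  have hI := hI _ hq
  rcases v with ⟨s, s'⟩ | ⟨s, i, σ, s'⟩ | _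
  · cases maskingGraph_ref_move htot hE with
    | refSpec hσ ht =>
      rw [faultCost_ordinary hd hσ, zero_add] at hI
      exact ⟨hσ, hI.exists_impl hσ ht⟩
    | refImpl hσ ht =>
      rcases hσ with hσ | hf
      · rw [faultCost_ordinary hd hσ, zero_add] at hI
        exact .inl ⟨hσ, hI.exists_spec hσ ht⟩
      · rw [faultCost_fault hf, add_comm] at hI
        exact .inr ⟨hf, hI.fault hf ht⟩
  · exact absurd hv (ver_notMem_P₁ _ _ _ _)
  · exact hI.elim

theorem value₂_le_of_verifierSafe [Finite S] [Finite S'] (hd : Disjoint N F)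
    (htot : ∀ s, ∃ σ ∈ N, ∃ t, E s σ t) {k : ℕ} (hS : VerifierSafe E E' N F k s₀ s₀') :
    (maskingGraph E E' N F s₀ s₀').value₂ (maskingPayoff F) ≤ 1 / (1 + ((k + 1 : ℕ) : ℝ)) := by
  have hN : N.Nonempty := (htot s₀).imp fun _ h => h.1
  obtain ⟨π₂, hπ⟩ := GameGraph.exists_strategy₂_of_invariant (G := maskingGraph E E' N F s₀ s₀')
    (Inv := VerifierInv E E' N F k) (maskingGraph_total hN)
    (fun r hr => by
      obtain rfl : r = k := by simpa using hr
      exact hS)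
    (fun _ _ hv hI => hI.exists_step hd hN hv) (fun _ _ hv hI _ _ hE => hI.step hd htot hv hE)
  refine GameGraph.value₂_le (maskingGraph_total hN) (maskingPayoff_nonneg hd)
    (maskingPayoff_le_one hd) π₂ fun π₁ => ?_
  refine maskingPayoff_le_of_faults hd _ fun n hn => ?_
  rw [← faultCount_outcomeAt]
  have hI := hπ π₁ n
  have hn : (GameGraph.outcomeAt _ π₁ π₂ n).2 = .err := hn
  rw [hn] at hI
  by_contra hlt
  -- If at most `k` faults had occurred, the remaining budget would instantiate the invariant at the
  -- error node, where it is false.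
  exact hI (k - faultCount F (GameGraph.outcomeAt _ π₁ π₂ n).1) (by omega)

theorem nonpos_of_forall_le_one_div {x : ℝ} (h : ∀ k : ℕ, x ≤ 1 / (1 + ((k + 1 : ℕ) : ℝ))) :
    x ≤ 0 := by
  by_contra! hx
  obtain ⟨n, hn⟩ := exists_nat_one_div_lt hx
  refine (hn.trans_le (h n)).not_ge ?_
  push_cast
  exact one_div_le_one_div_of_le (by positivity) (by linarith)

/-- Masking games are determined, and their value is governed by the least number of faults with
which the refuter can force the error node. -/
theorem maskingGraph_determined [Finite S] [Finite S'] (hd : Disjoint N F)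
    (htot : ∀ s, ∃ σ ∈ N, ∃ t, E s σ t) :
    (maskingGraph E E' N F s₀ s₀').value₁ (maskingPayoff F) =
      (maskingGraph E E' N F s₀ s₀').value₂ (maskingPayoff F) := by
  have hN : N.Nonempty := (htot s₀).imp fun _ h => h.1
  have hG := maskingGraph_total (E := E) (E' := E') (F := F) (s₀ := s₀) (s₀' := s₀') hN
  refine (GameGraph.value₁_le_value₂ hG (maskingPayoff_nonneg hd)
    (maskingPayoff_le_one hd)).antisymm ?_
  by_cases h : ∃ k, ¬ VerifierSafe E E' N F k s₀ s₀'
  · classical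
    obtain ⟨n, hn⟩ := not_forall_not.1 (Nat.find_spec h)
    refine le_trans ?_ (le_value₁_of_refuterWins hd hN hn)
    -- If the least `k` is `0`, the required bound is the trivial `1`; otherwise safety at its
    -- predecessor gives exactly `1 / (1 + k)`.
    rcases hk : Nat.find h with _ | k
    · simpa using GameGraph.value₂_le_one hG (maskingPayoff_nonneg hd) (maskingPayoff_le_one hd)
    · exact value₂_le_of_verifierSafe hd htot (not_not.1 (Nat.find_min h (by omega : k < _)))
  · push Not at h
    exact (nonpos_of_forall_le_one_div fun k => value₂_le_of_verifierSafe hd htot (h k)).trans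
      (GameGraph.value₁_nonneg hG (maskingPayoff_nonneg hd) (maskingPayoff_le_one hd))

theorem maskingGraph_value₂_nonneg (hd : Disjoint N F) (hN : N.Nonempty) :
    0 ≤ (maskingGraph E E' N F s₀ s₀').value₂ (maskingPayoff F) :=
  have hG := maskingGraph_total (E := E) (E' := E') (F := F) (s₀ := s₀) (s₀' := s₀') hN
  (GameGraph.value₁_nonneg hG (maskingPayoff_nonneg hd) (maskingPayoff_le_one hd)).trans
    (GameGraph.value₁_le_value₂ hG (maskingPayoff_nonneg hd) (maskingPayoff_le_one hd))

/-- Emptiness of `F` is a hypothesis because the fault set arises as a difference `F \ F`. -/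
theorem maskingGraph_value₂_refl [Finite S] (hF : F = ∅) (htot : ∀ s, ∃ σ ∈ N, ∃ t, E s σ t) :
    (maskingGraph E E N F s₀ s₀).value₂ (maskingPayoff F) = 0 := by
  subst hF
  exact (nonpos_of_forall_le_one_div fun k => value₂_le_of_verifierSafe (Set.disjoint_empty N) htot
    (verifierSafe_refl k s₀)).antisymm
    (maskingGraph_value₂_nonneg (Set.disjoint_empty N) ((htot s₀).imp fun _ h => h.1))

/-- The triangle inequality for masking games, in the strong form with a maximum. -/
theorem maskingGraph_value₂_le_max [Finite S] [Finite S'] [Finite S''] {N₁ N₂ F₁ F₂ F₃ : Set L}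
    {s₀'' : S''} (hN : N₁ ⊆ N₂) (hF : ∀ f ∈ F₃, (f ∈ N₂ ∧ f ∈ F₁) ∨ f ∈ F₂)
    (hd₁ : Disjoint N₁ F₁) (hd₂ : Disjoint N₂ F₂) (hd₃ : Disjoint N₁ F₃)
    (htot₁ : ∀ s, ∃ σ ∈ N₁, ∃ t, E s σ t) (htot₂ : ∀ s, ∃ σ ∈ N₂, ∃ t, E' s σ t) :
    (maskingGraph E E'' N₁ F₃ s₀ s₀'').value₂ (maskingPayoff F₃) ≤
      max ((maskingGraph E E' N₁ F₁ s₀ s₀').value₂ (maskingPayoff F₁))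
        ((maskingGraph E' E'' N₂ F₂ s₀' s₀'').value₂ (maskingPayoff F₂)) := by
  have hN₁ : N₁.Nonempty := (htot₁ s₀).imp fun _ h => h.1
  have hN₂ : N₂.Nonempty := hN₁.mono hN
  have key : ∀ k n, RefuterWins E E'' N₁ F₃ n k s₀ s₀'' →
      1 / (1 + (k : ℝ)) ≤ max ((maskingGraph E E' N₁ F₁ s₀ s₀').value₂ (maskingPayoff F₁))
        ((maskingGraph E' E'' N₂ F₂ s₀' s₀'').value₂ (maskingPayoff F₂)) := by
    intro k n hn
    -- Refuter strategies bound `value₁` from below, so determinacy of the two components is needed.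
    rw [← maskingGraph_determined hd₁ htot₁, ← maskingGraph_determined hd₂ htot₂]
    by_cases h₁ : VerifierSafe E E' N₁ F₁ k s₀ s₀'
    · by_cases h₂ : VerifierSafe E' E'' N₂ F₂ k s₀' s₀''
      · exact (h₁.trans hN hF h₂ n hn).elim
      · obtain ⟨m, hm⟩ := not_forall_not.1 h₂
        exact le_max_of_le_right (le_value₁_of_refuterWins hd₂ hN₂ hm)
    · obtain ⟨m, hm⟩ := not_forall_not.1 h₁
      exact le_max_of_le_left (le_value₁_of_refuterWins hd₁ hN₁ hm)
  by_cases h : ∃ k, ¬ VerifierSafe E E'' N₁ F₃ k s₀ s₀''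
  · classical
    obtain ⟨n, hn⟩ := not_forall_not.1 (Nat.find_spec h)
    refine le_trans ?_ (key _ n hn)
    rcases hk : Nat.find h with _ | k
    · simpa using GameGraph.value₂_le_one (maskingGraph_total hN₁) (maskingPayoff_nonneg hd₃)
        (maskingPayoff_le_one hd₃)
    · exact value₂_le_of_verifierSafe hd₃ htot₁ (not_not.1 (Nat.find_min h (by omega : k < _)))
  · push Not at h
    exact (nonpos_of_forall_le_one_div fun k => value₂_le_of_verifierSafe hd₃ htot₁ (h k)).trans
      (le_max_of_le_left (maskingGraph_value₂_nonneg hd₁ hN₁))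

end Values

/-! ### The strong and weak games satisfy the assumptions -/

namespace TransitionSystem

variable {L S S' : Type*} {Sig F F' : Set L}

theorem strong_total (A : TransitionSystem S Sig F) (s : S) :
    ∃ σ ∈ Sig ∪ F, ∃ t, A.Tr s σ t := by
  obtain ⟨σ, t, h⟩ := A.total s
  exact ⟨σ, A.label_mem h, t, h⟩

/-- The empty run is a weak `τ`-transition. -/
theorem weak_total (A : TransitionSystem S Sig F) (τ : L) (s : S) :
    ∃ σ ∈ Sig ∪ F ∪ {τ}, ∃ t, A.WeakTr τ s σ t :=
  ⟨τ, .inr rfl, s, by rw [WeakTr, if_pos rfl]⟩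

theorem strong_disjoint (A' : TransitionSystem S' Sig F') : Disjoint (Sig ∪ F) (F' \ F) :=
  Set.disjoint_union_left.2 ⟨A'.disjoint.mono_right Set.sdiff_subset, Set.disjoint_sdiff_right⟩

theorem weak_disjoint (A' : TransitionSystem S' Sig F') {τ : L} (hτ : τ ∉ F') :
    Disjoint (Sig ∪ F ∪ {τ}) (F' \ F) :=
  Set.disjoint_union_left.2
    ⟨A'.strong_disjoint, Set.disjoint_singleton_left.2 fun h => hτ h.1⟩

end TransitionSystem

end Masking

theorem mainTheorem1 {L : Type*} (Sig : Set L) :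
    -- the distances are well defined (the games are determined) and nonnegative
    (∀ {S S' : Type*} {F F' : Set L} (A : TransitionSystem S Sig F) (A' : TransitionSystem S' Sig F'),
      F ⊆ F' →
        (A.strongValR A' = A.strongDist A' ∧ A.strongValV A' = A.strongDist A' ∧
          0 ≤ A.strongDist A') ∧
        ∀ τ ∉ F', A.weakValR τ A' = A.weakDist τ A' ∧ A.weakValV τ A' = A.weakDist τ A' ∧
          0 ≤ A.weakDist τ A') ∧
    -- reflexivity
    (∀ {S : Type*} {F : Set L} (A : TransitionSystem S Sig F),
      A.strongDist A = 0 ∧ ∀ τ ∉ F, A.weakDist τ A = 0) ∧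
    -- triangle inequality; the case `F = ∅` is that of a nominal system `A` over `Sig`
    (∀ {S S' S'' : Type*} {F F' F'' : Set L} (A : TransitionSystem S Sig F)
      (A' : TransitionSystem S' Sig F') (A'' : TransitionSystem S'' Sig F''),
      F ⊆ F' → F' ⊆ F'' →
        A.strongDist A'' ≤ A.strongDist A' + A'.strongDist A'' ∧
        ∀ τ ∉ F'', A.weakDist τ A'' ≤ A.weakDist τ A' + A'.weakDist τ A'') := by

  refine ⟨?_, ?_, ?_⟩
  · intro S S' F F' A A' _
    have := A.finite_states
    have := A'.finite_states
    refine ⟨⟨maskingGraph_determined A'.strong_disjoint A.strong_total, rfl,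
      maskingGraph_value₂_nonneg A'.strong_disjoint ((A.strong_total A.init).imp fun _ h => h.1)⟩,
      fun τ hτ => ⟨maskingGraph_determined (A'.weak_disjoint hτ) (A.weak_total τ), rfl,
        maskingGraph_value₂_nonneg (A'.weak_disjoint hτ) ⟨τ, .inr rfl⟩⟩⟩
  · intro S F A
    have := A.finite_states
    exact ⟨maskingGraph_value₂_refl sdiff_self A.strong_total,
      fun τ _ => maskingGraph_value₂_refl sdiff_self (A.weak_total τ)⟩
  · intro S S' S'' F F' F'' A A' A'' hF hF'
    have := A.finite_states
    have := A'.finite_states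
    have := A''.finite_states
    -- A fault new relative to `A` either appears already in `A'`, and is then ordinary in the
    -- second game, or is new in `A''`.
    have hsplit : ∀ f ∈ F'' \ F, (f ∈ Sig ∪ F' ∧ f ∈ F' \ F) ∨ f ∈ F'' \ F' := fun f hf => by
      by_cases h : f ∈ F'
      · exact .inl ⟨.inr h, h, hf.2⟩
      · exact .inr ⟨hf.1, h⟩
    constructor
    · have h := maskingGraph_value₂_le_max (E'' := A''.Tr) (s₀ := A.init) (s₀' := A'.init)
        (s₀'' := A''.init) (Set.union_subset_union_right Sig hF) hsplit A'.strong_disjoint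
        A''.strong_disjoint A''.strong_disjoint A.strong_total A'.strong_total
      exact h.trans (max_le_add_of_nonneg
        (maskingGraph_value₂_nonneg A'.strong_disjoint ((A.strong_total A.init).imp fun _ h => h.1))
        (maskingGraph_value₂_nonneg A''.strong_disjoint
          ((A'.strong_total A'.init).imp fun _ h => h.1)))
    · intro τ hτ
      have hτ' : τ ∉ F' := fun h => hτ (hF' h)
      have h := maskingGraph_value₂_le_max (E'' := A''.WeakTr τ) (s₀ := A.init) (s₀' := A'.init)
        (s₀'' := A''.init) (Set.union_subset_union_left {τ} (Set.union_subset_union_right Sig hF))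
        (fun f hf => (hsplit f hf).imp_left (And.imp_left Or.inl)) (A'.weak_disjoint hτ')
        (A''.weak_disjoint hτ) (A''.weak_disjoint hτ) (A.weak_total τ) (A'.weak_total τ)
      exact h.trans (max_le_add_of_nonneg
        (maskingGraph_value₂_nonneg (A'.weak_disjoint hτ') ⟨τ, .inr rfl⟩)
        (maskingGraph_value₂_nonneg (A''.weak_disjoint hτ) ⟨τ, .inr rfl⟩))
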